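/- For an integer matrix $E\in\mathbb Z^{d\times n}$ let $\mathcal G(E)$ be its Graver basis: the set of nonzero $v\in\ker(E)\cap\mathbb Z^n$ that cannot be written as $v=v'+v''$ with nonzero $v',v''\in\ker(E)\cap\mathbb Z^n$ such that $v,v',v''$ lie in a common orthant. For $A\in\mathbb Z^{d_A\times n_A}$, $B\in\mathbb Z^{d_A\times n_B}$, $C\in\mathbb Z^{d_C\times n_B}$, $D\in\mathbb Z^{d_C\times n_A}$ and $N\in\mathbb Z_{\ge0}$ put \[ L_N=\begin{pmatrix}B&A&&\\ \vdots&&\ddots&\\ B&&&A\end{pmatrix},\qquad E_N=\begin{pmatrix}C&D&\cdots&D\\ B&A&&\\ \vdots&&\ddots&\\ B&&&A\end{pmatrix} \] ($N$ copies of $A$, $B$ and $D$). Call $(g,\xi,\eta)\in\mathbb Z_{\ge0}^3$ \emph{stochastic constants} for $(A,B)$ if (a) $\|v\|_\infty\le g$ for all $N$ and all $v\in\mathcal G(L_N)$; (b) consequently $\|v\|_1\le(n_B+Nn_A)g$ for these $v$; (c) there are a set $X\subseteq\mathbb Z^{n_B}$ with $|X|\le\xi$ and sets $Y_x\subseteq\mathbb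 Z^{n_A}$ with $|Y_x|\le\eta$ for $x\in X$, such that for all $N$ every element of $\mathcal G(L_N)$ has the form $(x,y^1,\dots,y^N)$ with $x\in X$ and $y^1,\dots,y^N\in Y_x$. \textbf{Proposition.} Let $A\in\mathbb Z^{d_A\times n_A}$ and $B\in\mathbb Z^{d_A\times n_B}$. Stochastic constants for $(A,B)$ exist. Moreover, for all stochastic constants $(g,\xi_0,\eta)$ for $(A,B)$: (1) There is an integer $\xi\ge\xi_0$, independent of $d_C,C,D,M,N$ (so $(g,\xi,\eta)$ are again stochastic constants), such that for all $d_C\ge1$, $C\in\mathbb Z^{d_C\times n_B}$, $D\in\mathbb Z^{d_C\times n_A}$, every real $M\ge1$ bounding the absolute values of the entries of $C$ and $D$, every $N\in\mathbb Z_{\ge0}$ and every $v\in\mathcal G(E_N)$, \[ \|v\|_1\le \xi\,(N+\eta)^\eta\, d_C\,\bigl(\sqrt{d_C}\,(n_B+Nn_A)M\bigr)^{d_C}\,(n_B+Nn_A)\,g . \] (2) For all $d_C,C,D,M,N,v$ as in (1), \[ \|v\|_1\le \xi_0\,(N+\eta)^\eta\, d_C\,\bigl(\sqrt{d_C}\,(n_B+Nn_A)Mg\bigr)^{d_C}\,(n_B+Nn_A)\,g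 . \] (3) For all $d_C\ge0$ and fixed $C\in\mathbb Z^{d_C\times n_B}$, $D\in\mathbb Z^{d_C\times n_A}$ we have $\max\{\|v\|_1: v\in\mathcal G(E_N)\}=O(N^{d_C+\eta})$ for $N\ge1$ (the maximum over the empty set being $0$). -/

import Mathlib

open Matrix

namespace FourBlock

/-- The `ℓ₁`-norm of an integer vector. -/
def l1 {n : Type*} [Fintype n] (v : n → ℤ) : ℤ := ∑ i, |v i|

/-- The three vectors lie in one common orthant of `ℝⁿ`. -/
def CommonOrthant {n : Type*} (u v w : n → ℤ) : Prop :=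
  ∀ i, (0 ≤ u i ∧ 0 ≤ v i ∧ 0 ≤ w i) ∨ (u i ≤ 0 ∧ v i ≤ 0 ∧ w i ≤ 0)

/-- The Graver basis of an integer matrix `E`: the nonzero integer vectors in the kernel of `E`
that are not a sum of two nonzero integer kernel vectors lying in the same orthant. -/
def graver {m n : Type*} [Fintype n] (E : Matrix m n ℤ) : Set (n → ℤ) :=
  {v | v ≠ 0 ∧ E *ᵥ v = 0 ∧
    ¬ ∃ v' v'' : n → ℤ, v' ≠ 0 ∧ v'' ≠ 0 ∧ E *ᵥ v' = 0 ∧ E *ᵥ v'' = 0 ∧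
      v = v' + v'' ∧ CommonOrthant v v' v''}

/-- The lower blocks: `N` copies of `B` in the first block column, and `N` diagonal copies of `A`.
A column index is `inl j` (a first-stage variable) or `inr (j, k)` (variable `j` of the
`k`-th copy of `A`). -/
def lowerMatrix {dA nA nB : ℕ} (A : Matrix (Fin dA) (Fin nA) ℤ) (B : Matrix (Fin dA) (Fin nB) ℤ)
    (N : ℕ) : Matrix (Fin dA × Fin N) (Fin nB ⊕ Fin nA × Fin N) ℤ :=
  fromCols (of fun p j => B p.1 j) (blockDiagonal fun _ : Fin N => A)

/-- The upper blocks `(C, D, …, D)`. -/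
def upperMatrix {dC nA nB : ℕ} (C : Matrix (Fin dC) (Fin nB) ℤ) (D : Matrix (Fin dC) (Fin nA) ℤ)
    (N : ℕ) : Matrix (Fin dC) (Fin nB ⊕ Fin nA × Fin N) ℤ :=
  fromCols C (of fun i p => D i p.1)

/-- The `N`-fold 4-block matrix with blocks `C, D` (top) and `B, A` (bottom). -/
def fourBlock {dA dC nA nB : ℕ} (A : Matrix (Fin dA) (Fin nA) ℤ) (B : Matrix (Fin dA) (Fin nB) ℤ)
    (C : Matrix (Fin dC) (Fin nB) ℤ) (D : Matrix (Fin dC) (Fin nA) ℤ) (N : ℕ) :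
    Matrix (Fin dC ⊕ Fin dA × Fin N) (Fin nB ⊕ Fin nA × Fin N) ℤ :=
  fromRows (upperMatrix C D N) (lowerMatrix A B N)

/-- `g`, `ξ`, `η` are constants as in the structure theorem for the Graver bases of two-stage
stochastic integer programs: for all `N` simultaneously, Graver basis elements `(x, y¹, …, yᴺ)`
have entries bounded by `g`, their `x` lies in a set `X` of at most `ξ` vectors, and all `yᵏ` lie
in a set `Y x` of at most `η` vectors. -/
structure StochasticConstants {dA nA nB : ℕ} (A : Matrix (Fin dA) (Fin nA) ℤ)
    (B : Matrix (Fin dA) (Fin nB) ℤ) (g ξ η : ℕ) : Prop where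
  entry_le : ∀ (N : ℕ), ∀ v ∈ graver (lowerMatrix A B N), ∀ i, |v i| ≤ (g : ℤ)
  l1_le : ∀ (N : ℕ), ∀ v ∈ graver (lowerMatrix A B N), l1 v ≤ ((nB : ℤ) + N * nA) * g
  building_blocks : ∃ (X : Finset (Fin nB → ℤ)) (Y : (Fin nB → ℤ) → Finset (Fin nA → ℤ)),
    X.card ≤ ξ ∧ (∀ x ∈ X, (Y x).card ≤ η) ∧
    ∀ (N : ℕ), ∀ v ∈ graver (lowerMatrix A B N),
      (fun j => v (Sum.inl j)) ∈ X ∧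
      ∀ k : Fin N, (fun j => v (Sum.inr (j, k))) ∈ Y (fun j => v (Sum.inl j))

end FourBlock

namespace FourBlock

/-! Existence of the constants is a well-quasi-order argument: from infinitely many building blocks
one could assemble a nonzero kernel vector of some `L_N` lying strictly below a Graver element in
the conformal order. Since `N` varies, first-stage vectors also require comparing finite sets of
second-stage blocks, which Higman's lemma on boxes provides.

For the bounds, `v ∈ G(E_N)` lies in `ker L_N`, hence is a conformal sum of elements `u i` of
`G(L_N)`, each of norm at most `(nB + N nA) g`. It remains to bound their number. The vectors `w i =
(C D … D) u i` sum to zero, and no proper nonempty subfamily does, since its `u`-sum would be a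
kernel vector of `E_N` strictly below `v`.

The length of such a family is bounded by `card_le_of_irreducible_zero_sum`. The multiplicities of
the distinct values form a nonnegative relation; circuits are peeled off with step at most 1, each
eliminating a value. Cramer's rule and Hadamard's inequality bound the coefficient sum of a circuit
by `(k + 1) (√k m)^k`, where `k` is at most the rank. So the length is at most this bound times the
number of distinct values.

Because `D` is repeated, `w i` depends only on `(x, ∑ yᵏ)`, that is, on `x` and a multiset of `N`
blocks out of `η`; this gives polynomially many values in `N`. For the same reason `k ≤ nB + nA`, so
in (1) the factor `g ^ k` can be absorbed into `ξ`. -/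

/-! ### Well-quasi-orders -/

/-- The vectors lying above no element of a finite set form a finite union of boxes. -/
theorem exists_boxes_of_not_ge {σ : Type*} [Fintype σ] (F : Finset (σ → ℕ)) :
    ∃ l : List (σ → WithTop ℕ), ∀ b : σ → ℕ,
      (∀ a ∈ F, ¬ a ≤ b) ↔ ∃ β ∈ l, ∀ i, (b i : WithTop ℕ) < β i := by
  classical
  induction F using Finset.induction_on with
  | empty => exact ⟨[⊤], fun b => by simp⟩
  | insert a F _ ih =>
    obtain ⟨l, hl⟩ := ih
    -- `b` avoids the cone above `a` iff some `b i < a i`, so each old box is replaced by its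
    -- truncations at `a i`, one for each coordinate `i`.
    refine ⟨l.flatMap fun β => (Finset.univ : Finset σ).toList.map fun i =>
      β ⊓ Function.update ⊤ i (a i : WithTop ℕ), fun b => ?_⟩
    rw [Finset.forall_mem_insert, hl]
    simp only [Pi.le_def, not_forall, not_le, List.mem_flatMap, List.mem_map, Finset.mem_toList,
      Finset.mem_univ, true_and]
    constructor
    · rintro ⟨⟨i, hi⟩, β, hβ, h⟩
      refine ⟨_, ⟨β, hβ, i, rfl⟩, fun j => ?_⟩
      rw [Pi.inf_apply, lt_inf_iff]
      refine ⟨h j, ?_⟩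
      by_cases hj : j = i
      · subst hj; simpa using hi
      · simp [hj]
    · rintro ⟨_, ⟨β, hβ, i, rfl⟩, h⟩
      refine ⟨⟨i, ?_⟩, β, hβ, fun j => (lt_inf_iff.1 (h j)).1⟩
      simpa using (lt_inf_iff.1 (h i)).2

/-- Finite sets of vectors of natural numbers, ordered by reverse inclusion of their upward
closures, contain no infinite bad sequence. -/
theorem exists_lt_forall_exists_le {σ : Type*} [Fintype σ] (f : ℕ → Finset (σ → ℕ)) :
    ∃ m n, m < n ∧ ∀ b ∈ f n, ∃ a ∈ f m, a ≤ b := by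
  choose l hl using fun n => exists_boxes_of_not_ge (f n)
  have hpwo : (Set.univ : Set (σ → WithTop ℕ)).PartiallyWellOrderedOn (· ≤ ·) :=
    Set.partiallyWellOrderedOn_univ_iff.2
      (WellQuasiOrdered.pi fun _ => wellQuasiOrdered_le)
  -- Higman's lemma for lists of boxes: every box of `l m` is contained in one of `l n`. Passing to
  -- complements reverses the inclusion, so the upward closure of `f n` lies in that of `f m`.
  have hH := Set.PartiallyWellOrderedOn.partiallyWellOrderedOn_sublistForall₂ _ hpwo
  obtain ⟨m, n, hmn, hs⟩ := hH.exists_lt (f := l) (fun n => by simp)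
  refine ⟨m, n, hmn, fun b hb => ?_⟩
  by_contra! hcon
  obtain ⟨β, hβ, hbβ⟩ := (hl m b).1 hcon
  obtain ⟨l', h₁, h₂⟩ := List.sublistForall₂_iff.1 hs
  obtain ⟨γ, hγ, hle⟩ : ∃ γ ∈ l', β ≤ γ := by
    clear hs h₂
    generalize l m = l₀ at h₁ hβ
    induction h₁ with
    | nil => simp at hβ
    | cons h _ ih =>
      rcases List.mem_cons.1 hβ with rfl | h'
      · exact ⟨_, List.mem_cons_self, h⟩
      · obtain ⟨γ, hγ, h⟩ := ih h'
        exact ⟨γ, List.mem_cons_of_mem _ hγ, h⟩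
  exact (hl n b).2 ⟨γ, h₂.subset hγ, fun i => (hbβ i).trans_le (hle i)⟩ b hb le_rfl

/-! ### The conformal order -/

/-- `u` lies in the box spanned by `0` and `v`. -/
def Conformal {n : Type*} (u v : n → ℤ) : Prop :=
  ∀ i, (0 ≤ u i ∧ u i ≤ v i) ∨ (v i ≤ u i ∧ u i ≤ 0)

/-- The positive and negative parts of an integer vector. -/
def signParts {n : Type*} (v : n → ℤ) : n ⊕ n → ℕ :=
  Sum.elim (fun i => (v i).toNat) (fun i => (-v i).toNat)

theorem signParts_le_iff {n : Type*} {u v : n → ℤ} :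
    signParts u ≤ signParts v ↔ Conformal u v := by
  simp only [Pi.le_def, Sum.forall, signParts, Sum.elim_inl, Sum.elim_inr, Conformal,
    ← forall_and]
  refine forall_congr' fun i => ?_
  omega

theorem Conformal.refl {n : Type*} (v : n → ℤ) : Conformal v v := fun i => by
  rcases le_total 0 (v i) with h | h <;> simp [h]

theorem Conformal.trans {n : Type*} {u v w : n → ℤ} (h : Conformal u v) (h' : Conformal v w) :
    Conformal u w := fun i => by have := h i; have := h' i; omega

theorem Conformal.commonOrthant {n : Type*} {u v : n → ℤ} (h : Conformal u v) :
    CommonOrthant v u (v - u) := fun i => by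
  have := h i
  simp only [Pi.sub_apply]
  omega

theorem CommonOrthant.conformal {n : Type*} {u v : n → ℤ} (h : CommonOrthant (u + v) u v) :
    Conformal u (u + v) := fun i => by
  have := h i
  simp only [Pi.add_apply] at *
  omega

/-- Every infinite sequence of integer vectors contains a conformally increasing subsequence. -/
theorem exists_conformal_subseq {n : Type*} [Fintype n] (f : ℕ → n → ℤ) :
    ∃ φ : ℕ ↪o ℕ, ∀ i j, i ≤ j → Conformal (f (φ i)) (f (φ j)) := by
  have hw : WellQuasiOrdered ((· ≤ ·) : (n ⊕ n → ℕ) → (n ⊕ n → ℕ) → Prop) :=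
    WellQuasiOrdered.pi fun _ => wellQuasiOrdered_le
  obtain ⟨φ, hφ⟩ := hw.exists_monotone_subseq fun k => signParts (f k)
  exact ⟨φ, fun i j hij => signParts_le_iff.1 (hφ i j hij)⟩

/-- A Graver basis element is minimal among the nonzero kernel vectors. -/
theorem eq_of_conformal_of_mem_graver {m n : Type*} [Fintype n] {E : Matrix m n ℤ} {u v : n → ℤ}
    (hv : v ∈ graver E) (hu : u ≠ 0) (hE : E *ᵥ u = 0) (h : Conformal u v) : u = v := by
  by_contra hne
  exact hv.2.2 ⟨u, v - u, hu, sub_ne_zero.2 (Ne.symm hne), hE,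
    by rw [mulVec_sub, hv.2.1, hE, sub_zero], by abel, h.commonOrthant⟩

/-! ### Existence of the constants -/

theorem lowerMatrix_mulVec_eq_zero_iff {dA nA nB : ℕ} {A : Matrix (Fin dA) (Fin nA) ℤ}
    {B : Matrix (Fin dA) (Fin nB) ℤ} {N : ℕ} {v : Fin nB ⊕ Fin nA × Fin N → ℤ} :
    lowerMatrix A B N *ᵥ v = 0 ↔
      ∀ k, B *ᵥ (fun j => v (Sum.inl j)) + A *ᵥ (fun j => v (Sum.inr (j, k))) = 0 := by
  simp only [funext_iff, Prod.forall, lowerMatrix, mulVec, dotProduct, fromCols, of_apply,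
    Fintype.sum_sum_type, Sum.elim_inl, Sum.elim_inr, Fintype.sum_prod_type, blockDiagonal_apply,
    Pi.add_apply, Pi.zero_apply, ite_mul, zero_mul, Finset.sum_ite_eq, Finset.mem_univ, if_true]
  exact forall_comm

/-- Among infinitely many nonzero `x`, two are conformally comparable and, moreover, every block of
the larger element dominates some block of the smaller. Attaching those smaller blocks to the
smaller `x` gives a kernel vector below the larger element, against minimality. Discarding `x = 0`
keeps this vector nonzero. -/
theorem finite_firstStage_graver {dA nA nB : ℕ} (A : Matrix (Fin dA) (Fin nA) ℤ)
    (B : Matrix (Fin dA) (Fin nB) ℤ) :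
    {x : Fin nB → ℤ | ∃ N, ∃ v ∈ graver (lowerMatrix A B N),
      (fun j => v (Sum.inl j)) = x}.Finite := by
  classical
  refine Set.Finite.of_sdiff (t := {0}) ?_ (Set.finite_singleton _)
  by_contra hinf
  rw [← Set.Infinite] at hinf
  let x := hinf.natEmbedding
  obtain ⟨φ, hφ⟩ := exists_conformal_subseq fun k => (x k : Fin nB → ℤ)
  choose N v hv hx using fun k => (x (φ k)).2.1
  obtain ⟨a, b, hab, h⟩ := exists_lt_forall_exists_le fun k =>
    Finset.univ.image fun c : Fin (N k) => signParts fun j => v k (Sum.inr (j, c))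
  simp only [Finset.mem_image, Finset.mem_univ, true_and, exists_exists_eq_and,
    forall_exists_index, forall_apply_eq_imp_iff, signParts_le_iff] at h
  choose c hc using h
  let u : Fin nB ⊕ Fin nA × Fin (N b) → ℤ :=
    Sum.elim (fun j => v a (Sum.inl j)) (fun p => v a (Sum.inr (p.1, c p.2)))
  have hxa : (fun j => u (Sum.inl j)) = x (φ a) := hx a
  have hu0 : u ≠ 0 := by
    intro h0
    refine (x (φ a)).2.2 ?_
    rw [Set.mem_singleton_iff, ← hxa, h0]
    rfl
  have huv : u = v b := by
    refine eq_of_conformal_of_mem_graver (hv b) hu0 ?_ ?_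
    · rw [lowerMatrix_mulVec_eq_zero_iff]
      intro k
      exact lowerMatrix_mulVec_eq_zero_iff.1 (hv a).2.1 (c k)
    · rintro (j | ⟨j, k⟩)
      · have := hφ a b hab.le j
        rw [← hx a, ← hx b] at this
        exact this
      · exact hc k j
  have : x (φ a) = x (φ b) := by
    apply Subtype.ext
    rw [← hxa, ← hx b, huv]
  exact hab.ne (φ.injective (x.injective this))

/-- Blocks sharing the same `x` solve the same system `B x + A y = 0`, so a block can be exchanged
for a smaller one from another Graver element, even for another `N`; minimality forbids this. -/
theorem finite_secondStage_graver {dA nA nB : ℕ} (A : Matrix (Fin dA) (Fin nA) ℤ)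
    (B : Matrix (Fin dA) (Fin nB) ℤ) (x : Fin nB → ℤ) :
    {y : Fin nA → ℤ | ∃ N, ∃ v ∈ graver (lowerMatrix A B N), ∃ k : Fin N,
      (fun j => v (Sum.inl j)) = x ∧ (fun j => v (Sum.inr (j, k))) = y}.Finite := by
  classical
  refine Set.Finite.of_sdiff (t := {0}) ?_ (Set.finite_singleton _)
  by_contra hinf
  rw [← Set.Infinite] at hinf
  let y := hinf.natEmbedding
  obtain ⟨φ, hφ⟩ := exists_conformal_subseq fun k => (y k : Fin nA → ℤ)
  obtain ⟨N, v, hv, k, hx, hy⟩ := (y (φ 0)).2.1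
  obtain ⟨N', v', hv', k', hx', hy'⟩ := (y (φ 1)).2.1
  have hle : Conformal (y (φ 0) : Fin nA → ℤ) (y (φ 1)) := hφ 0 1 zero_le_one
  have hne : (y (φ 0) : Fin nA → ℤ) ≠ y (φ 1) := fun h =>
    zero_ne_one (φ.injective (y.injective (Subtype.ext h)))
  let u : Fin nB ⊕ Fin nA × Fin N' → ℤ := fun i => Sum.elim (fun j => x j)
    (fun p => if p.2 = k' then (y (φ 0) : Fin nA → ℤ) p.1 else v' (Sum.inr p)) i
  have huk : (fun j => u (Sum.inr (j, k'))) = y (φ 0) := by simp [u]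
  have hu : u = v' := by
    refine eq_of_conformal_of_mem_graver hv' ?_ ?_ ?_
    · intro h0
      refine (y (φ 0)).2.2 ?_
      rw [Set.mem_singleton_iff, ← huk, h0]
      rfl
    · rw [lowerMatrix_mulVec_eq_zero_iff]
      intro c
      by_cases hc : c = k'
      · subst hc
        rw [huk, ← hy]
        have := lowerMatrix_mulVec_eq_zero_iff.1 hv.2.1 k
        rwa [hx] at this
      · have := lowerMatrix_mulVec_eq_zero_iff.1 hv'.2.1 c
        rw [hx'] at this
        simpa [u, hc] using this
    · rintro (j | ⟨j, c⟩)
      · have : v' (Sum.inl j) = x j := congrFun hx' j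
        have h := Conformal.refl x j
        simpa [u, this] using h
      · by_cases hc : c = k'
        · subst hc
          have : v' (Sum.inr (j, c)) = (y (φ 1) : Fin nA → ℤ) j := congrFun hy' j
          simpa [u, this] using hle j
        · simpa [u, hc] using Conformal.refl v' (Sum.inr (j, c))
  exact hne (by rw [← huk, ← hy', hu])

theorem l1_le_card_mul {n : Type*} [Fintype n] {v : n → ℤ} {g : ℤ} (h : ∀ i, |v i| ≤ g) :
    l1 v ≤ Fintype.card n * g := by
  simpa [l1] using Finset.sum_le_card_nsmul Finset.univ (fun i => |v i|) g fun i _ => h i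

theorem exists_stochasticConstants {dA nA nB : ℕ} (A : Matrix (Fin dA) (Fin nA) ℤ)
    (B : Matrix (Fin dA) (Fin nB) ℤ) : ∃ g ξ η : ℕ, StochasticConstants A B g ξ η := by
  classical
  let X := (finite_firstStage_graver A B).toFinset
  let Y := fun x => (finite_secondStage_graver A B x).toFinset
  have hX : ∀ N, ∀ v ∈ graver (lowerMatrix A B N), (fun j => v (Sum.inl j)) ∈ X :=
    fun N v hv => (Set.Finite.mem_toFinset _).2 ⟨N, v, hv, rfl⟩
  have hY : ∀ N, ∀ v ∈ graver (lowerMatrix A B N), ∀ k,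
      (fun j => v (Sum.inr (j, k))) ∈ Y (fun j => v (Sum.inl j)) :=
    fun N v hv k => (Set.Finite.mem_toFinset _).2 ⟨N, v, hv, k, rfl, rfl⟩
  let g : ℕ := (∑ x ∈ X, ∑ j, (x j).natAbs) + ∑ x ∈ X, ∑ y ∈ Y x, ∑ j, (y j).natAbs
  have hg : ∀ N, ∀ v ∈ graver (lowerMatrix A B N), ∀ i, |v i| ≤ (g : ℤ) := by
    intro N v hv i
    rw [Int.abs_eq_natAbs, Nat.cast_le]
    obtain j | ⟨j, k⟩ := i
    · refine le_trans ?_ (Nat.le_add_right _ _)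
      refine le_trans ?_ (Finset.single_le_sum (f := fun x : Fin nB → ℤ => ∑ j, (x j).natAbs)
        (fun _ _ => Nat.zero_le _) (hX N v hv))
      exact Finset.single_le_sum (f := fun j => (v (Sum.inl j)).natAbs)
        (fun _ _ => Nat.zero_le _) (Finset.mem_univ j)
    · refine le_trans ?_ (Nat.le_add_left _ _)
      refine le_trans ?_ (Finset.single_le_sum
        (f := fun x : Fin nB → ℤ => ∑ y ∈ Y x, ∑ j, (y j).natAbs)
        (fun _ _ => Nat.zero_le _) (hX N v hv))
      refine le_trans ?_ (Finset.single_le_sum (f := fun y : Fin nA → ℤ => ∑ j, (y j).natAbs)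
        (fun _ _ => Nat.zero_le _) (hY N v hv k))
      exact Finset.single_le_sum (f := fun j => (v (Sum.inr (j, k))).natAbs)
        (fun _ _ => Nat.zero_le _) (Finset.mem_univ j)
  refine ⟨g, X.card, ∑ x ∈ X, (Y x).card, hg, fun N v hv => ?_, X, Y, le_rfl, fun x hx => ?_,
    fun N v hv => ⟨hX N v hv, hY N v hv⟩⟩
  · refine (l1_le_card_mul (hg N v hv)).trans_eq ?_
    simp [mul_comm]
  · exact Finset.single_le_sum (f := fun x => (Y x).card) (fun _ _ => Nat.zero_le _) hx

/-! ### Hadamard's bound and selection of rows -/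

/-- Hadamard's determinant bound for matrices with bounded entries. -/
theorem abs_det_le_sqrt_card_mul_pow {ι : Type*} [Fintype ι] [DecidableEq ι] (Q : Matrix ι ι ℝ)
    {m : ℝ} (hm : ∀ i j, |Q i j| ≤ m) :
    |Q.det| ≤ (√(Fintype.card ι : ℝ) * m) ^ Fintype.card ι := by
  rcases isEmpty_or_nonempty ι with h | h
  · simp
  set c := Fintype.card ι with hc
  have hc0 : (0 : ℝ) < c := by exact_mod_cast Fintype.card_pos
  have hm0 : 0 ≤ m := (abs_nonneg _).trans (hm h.some h.some)
  have hP : (Q * Qᴴ).PosSemidef := posSemidef_self_mul_conjTranspose Q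
  have hdet : Q.det ^ 2 = ∏ i, hP.isHermitian.eigenvalues i := by
    have := hP.isHermitian.det_eq_prod_eigenvalues
    simpa [det_mul, det_conjTranspose, sq] using this
  have htr : ∑ i, hP.isHermitian.eigenvalues i ≤ c * (c * m ^ 2) := by
    have h1 := hP.isHermitian.trace_eq_sum_eigenvalues
    have h2 : (Q * Qᴴ).trace = ∑ i, ∑ j, Q i j ^ 2 := by
      simp [trace, mul_apply, sq]
    have h3 : ∑ i, ∑ j, Q i j ^ 2 ≤ ∑ _i : ι, ∑ _j : ι, m ^ 2 :=
      Finset.sum_le_sum fun i _ => Finset.sum_le_sum fun j _ =>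
        sq_le_sq.2 ((hm i j).trans (le_abs_self m))
    simp only [Finset.sum_const, Finset.card_univ, nsmul_eq_mul, ← hc] at h3
    rw [← h2, h1] at h3
    simpa using h3
  have hpos : ∀ i, 0 ≤ hP.isHermitian.eigenvalues i := hP.eigenvalues_nonneg
  -- AM-GM on the eigenvalues of `Q Qᴴ`, whose product is `det Q ^ 2` and whose sum is the sum of
  -- the squared entries of `Q`.
  have hamgm : ∏ i, hP.isHermitian.eigenvalues i ≤ (c * m ^ 2) ^ c := by
    have h1 := Real.geom_mean_le_arith_mean Finset.univ (fun _ => (1 : ℝ))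
      hP.isHermitian.eigenvalues (fun _ _ => zero_le_one) (by simp [Fintype.card_pos]) (fun i _ => hpos i)
    simp only [Real.rpow_one, Finset.sum_const, Finset.card_univ, nsmul_eq_mul, mul_one, one_mul,
      ← hc] at h1
    have h2 : (∑ i, hP.isHermitian.eigenvalues i) / c ≤ c * m ^ 2 := by
      rw [div_le_iff₀ hc0]
      linarith
    have hprod := Finset.prod_nonneg (s := Finset.univ) fun i _ => hpos i
    calc ∏ i, hP.isHermitian.eigenvalues i
        = ((∏ i, hP.isHermitian.eigenvalues i) ^ (c : ℝ)⁻¹) ^ c := by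
          rw [← Real.rpow_natCast, ← Real.rpow_mul hprod, inv_mul_cancel₀ hc0.ne', Real.rpow_one]
      _ ≤ (c * m ^ 2) ^ c :=
          pow_le_pow_left₀ (Real.rpow_nonneg hprod _) (h1.trans h2) _
  refine abs_le_of_sq_le_sq ?_ (by positivity)
  rw [hdet, ← pow_mul, mul_comm c 2, pow_mul, mul_pow, Real.sq_sqrt hc0.le]
  exact hamgm

/-- A matrix with linearly independent columns has a nonsingular square submatrix consisting of
as many rows. -/
theorem exists_submatrix_det_ne_zero {κ s : Type*} [Fintype κ] [Fintype s] [DecidableEq s]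
    (P : Matrix κ s ℝ) (hP : LinearIndependent ℝ P.col) :
    ∃ a : s → κ, (P.submatrix a id).det ≠ 0 := by
  classical
  obtain ⟨τ, a, ha, hspan, hli⟩ := exists_linearIndependent' ℝ P.row
  have : Fintype τ := Fintype.ofInjective a ha
  have hrank : P.rank = Fintype.card s := by
    rw [← rank_transpose]
    exact LinearIndependent.rank_matrix hP
  have hcard : Fintype.card s = Fintype.card τ := by
    rw [← hrank, rank_eq_finrank_span_row, ← hspan, finrank_span_eq_card hli]
  let e : s ≃ τ := Fintype.equivOfCardEq hcard
  refine ⟨a ∘ e, ?_⟩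
  have : LinearIndependent ℝ (P.submatrix (a ∘ e) id).row := hli.comp e e.injective
  exact ((isUnit_iff_isUnit_det _).1 (linearIndependent_rows_iff_isUnit.1 this)).ne_zero

/-! ### Circuits -/

/-- A nonnegative nonzero linear relation can be thinned out until removing one of its vectors
leaves a linearly independent set. -/
theorem exists_relation_linearIndepOn {ι V : Type*} [Fintype ι] [DecidableEq ι] [AddCommGroup V]
    [Module ℝ V] (f : ι → V) (l : ι → ℝ) (hl : ∀ i, 0 ≤ l i) (hl0 : l ≠ 0)
    (hf : ∑ i, l i • f i = 0) :
    ∃ (μ : ι → ℝ) (j : ι) (s : Finset ι), j ∉ s ∧ (∀ i, 0 ≤ μ i) ∧ 0 < μ j ∧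
      (∀ i, μ i ≠ 0 → i = j ∨ i ∈ s) ∧ (∀ i, μ i ≠ 0 → l i ≠ 0) ∧ ∑ i, μ i • f i = 0 ∧
      LinearIndepOn ℝ f (s : Set ι) := by
  induction hn : (Finset.univ.filter fun i => l i ≠ 0).card using Nat.strong_induction_on
    generalizing l with
  | _ n ih =>
  obtain ⟨j, hj⟩ := Function.ne_iff.1 hl0
  set s := (Finset.univ.filter fun i => l i ≠ 0).erase j with hs
  by_cases hli : LinearIndepOn ℝ f (s : Set ι)
  · refine ⟨l, j, s, by simp [hs], hl, lt_of_le_of_ne (hl j) (Ne.symm hj), fun i hi => ?_,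
      fun i hi => hi, hf, hli⟩
    by_cases hij : i = j
    · exact Or.inl hij
    · exact Or.inr (by simp [hs, hij, hi])
  · obtain ⟨b, hb, hb0⟩ : ∃ b : ι → ℝ, ∑ i ∈ s, b i • f i = 0 ∧ ∃ i ∈ s, 0 < b i := by
      obtain ⟨b, hb, i, hi, hbi⟩ := not_linearIndepOn_finset_iff.1 hli
      rcases lt_or_gt_of_ne hbi with h | h
      · exact ⟨fun i => -b i, by simp [hb], i, hi, by simpa using h⟩
      · exact ⟨b, hb, i, hi, h⟩
    -- Ratio test: the largest multiple of `b` that keeps all coefficients nonnegative annihilates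
    -- `i₁`. As `b` is used only on `s`, the coefficient of `j` is untouched and the relation stays
    -- nonzero.
    obtain ⟨i₁, hi₁, hmin⟩ := Finset.exists_min_image (s.filter fun i => 0 < b i)
      (fun i => l i / b i) (by obtain ⟨i, hi, h⟩ := hb0; exact ⟨i, by simp [hi, h]⟩)
    rw [Finset.mem_filter] at hi₁
    set t := l i₁ / b i₁ with ht
    have ht0 : 0 ≤ t := div_nonneg (hl _) hi₁.2.le
    let l' : ι → ℝ := fun i => l i - t * if i ∈ s then b i else 0
    have hl'j : l' j = l j := by simp [l', hs]
    have hsupp : ∀ i, l' i ≠ 0 → l i ≠ 0 := by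
      intro i hi h0
      refine hi ?_
      simp [l', hs, h0]
    have hl'i₁ : l' i₁ = 0 := by
      simp only [l', hi₁.1, if_true, ht]
      rw [div_mul_cancel₀ _ hi₁.2.ne', sub_self]
    have hli₁ : l i₁ ≠ 0 := by
      have := hi₁.1
      simp only [hs, Finset.mem_erase, Finset.mem_filter] at this
      exact this.2.2
    have hlt : (Finset.univ.filter fun i => l' i ≠ 0).card < n := by
      rw [← hn]
      refine Finset.card_lt_card (Finset.ssubset_iff_of_subset ?_ |>.2 ⟨i₁, ?_, ?_⟩)
      · intro i hi
        simp only [Finset.mem_filter, Finset.mem_univ, true_and] at hi ⊢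
        exact hsupp i hi
      · simpa using hli₁
      · simpa using hl'i₁
    obtain ⟨μ, j', s', h1, h2, h3, h4, h5, h6, h7⟩ := ih _ hlt l' (fun i => by
        simp only [l']
        split_ifs with his
        · rcases le_or_gt (b i) 0 with hbi | hbi
          · nlinarith [hl i]
          · have := hmin i (by simp [his, hbi])
            rw [le_div_iff₀ hbi] at this
            linarith
        · simpa using hl i)
      (fun h0 => hj (by rw [← hl'j, h0]))
      (by
        simp only [l', sub_smul, Finset.sum_sub_distrib, hf, mul_smul, ← Finset.smul_sum, ite_smul,
          zero_smul, Finset.sum_ite_mem, Finset.univ_inter, hb]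
        simp) rfl
    exact ⟨μ, j', s', h1, h2, h3, h4, fun i hi => hsupp i (h5 i hi), h6, h7⟩

/-- A nonnegative linear relation among integer vectors contains in its support a nonnegative
integer relation whose coefficients are bounded by minors. -/
theorem exists_circuit {ι κ : Type*} [Fintype ι] [Fintype κ] (f : ι → κ → ℤ) {m K : ℝ}
    (hm : ∀ i j, |(f i j : ℝ)| ≤ m)
    (hK : ∀ (k : ℕ) (e : Fin k → ι), LinearIndependent ℝ (fun i j => (f (e i) j : ℝ)) →
      ((k : ℝ) + 1) * (√(k : ℝ) * m) ^ k ≤ K)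
    (l : ι → ℝ) (hl : ∀ i, 0 ≤ l i) (hl0 : l ≠ 0) (hf : ∀ j, ∑ i, l i * f i j = 0) :
    ∃ c : ι → ℕ, c ≠ 0 ∧ (∀ i, c i ≠ 0 → l i ≠ 0) ∧ ∑ i, c i • f i = 0 ∧
      ∑ i, (c i : ℝ) ≤ K := by
  classical
  obtain ⟨μ, j₀, s, hj₀, hμ, hμj, hsupp, hμl, hrel, hli⟩ :=
    exists_relation_linearIndepOn (fun i j => (f i j : ℝ)) l hl hl0
      (by ext j; simpa using hf j)
  have hrel' : ∀ j, μ j₀ * f j₀ j + ∑ i : s, μ i * f i j = 0 := by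
    intro j
    have h := congrFun hrel j
    simp only [Finset.sum_apply, Pi.smul_apply, smul_eq_mul, Pi.zero_apply] at h
    rw [← h, Finset.sum_coe_sort s (fun i => μ i * (f i j : ℝ)),
      ← Finset.sum_insert (f := fun i => μ i * (f i j : ℝ)) hj₀]
    refine Finset.sum_subset (Finset.subset_univ _) fun i _ hi => ?_
    have : μ i = 0 := by
      by_contra h0
      exact hi (Finset.mem_insert.2 (hsupp i h0))
    simp [this]
  have hli' : LinearIndependent ℝ (fun (i : s) (j : κ) => (f i j : ℝ)) := hli
  obtain ⟨a, ha⟩ := exists_submatrix_det_ne_zero (Matrix.of fun (j : κ) (i : s) => (f i j : ℝ))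
    hli'
  let Q : Matrix s s ℤ := Matrix.of fun r i => f i (a r)
  let q : s → ℤ := fun r => f j₀ (a r)
  -- The selected rows determine the relation up to scaling; Cramer's rule makes it integral, with
  -- minors as coefficients.
  let z : s → ℤ := cramer Q q
  have hQ : (Q.det : ℝ) = (Q.map (Int.cast : ℤ → ℝ)).det := Int.cast_det Q
  have hQ0 : (Q.map (Int.cast : ℤ → ℝ)).det ≠ 0 := ha
  have hz : ∀ i : s, (Q.det : ℝ) * μ i = - μ j₀ * z i := by
    have h1 : Q.map (Int.cast : ℤ → ℝ) *ᵥ (fun i => (Q.det : ℝ) * μ i + μ j₀ * z i) = 0 := by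
      ext r
      have h2 := congrArg (Int.cast : ℤ → ℝ) (congrFun (mulVec_cramer Q q) r)
      have h3 := hrel' (a r)
      simp only [mulVec, dotProduct, Pi.smul_apply, smul_eq_mul, Int.cast_sum, Int.cast_mul] at h2
      simp only [mulVec, dotProduct, map_apply, Pi.zero_apply, mul_add, Finset.sum_add_distrib]
      have h4 : ∑ i, (Q r i : ℝ) * ((Q.det : ℝ) * μ i) = Q.det * ∑ i : s, μ i * f i (a r) := by
        rw [Finset.mul_sum]
        exact Finset.sum_congr rfl fun i _ => by simp only [Q, of_apply]; ring
      have h5 : ∑ i, (Q r i : ℝ) * (μ j₀ * z i) = μ j₀ * ((Q.det : ℝ) * q r) := by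
        rw [← h2, Finset.mul_sum]
        exact Finset.sum_congr rfl fun i _ => by simp only [z]; ring
      rw [h4, h5]
      have h6 : (q r : ℝ) = f j₀ (a r) := rfl
      rw [h6]
      linear_combination (Q.det : ℝ) * h3
    have h2 := eq_zero_of_mulVec_eq_zero hQ0 h1
    intro i
    have := congrFun h2 i
    simp only [Pi.zero_apply] at this
    linarith
  have hdet0 : (Q.det : ℝ) ≠ 0 := hQ ▸ hQ0
  let c : ι → ℕ := fun i => if h : i ∈ s then (z ⟨i, h⟩).natAbs else
    if i = j₀ then Q.det.natAbs else 0
  -- Proportionality to `μ` makes `c` a relation in all coordinates, not only those selected for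
  -- `Q`.
  have hc : ∀ i, (c i : ℝ) = |(Q.det : ℝ)| / μ j₀ * μ i := by
    intro i
    simp only [c]
    split_ifs with h1 h2
    · have h := congrArg abs (hz ⟨i, h1⟩)
      simp only [abs_mul, abs_neg, abs_of_nonneg (hμ i), abs_of_pos hμj] at h
      rw [Nat.cast_natAbs, Int.cast_abs, div_mul_eq_mul_div, h, mul_div_cancel_left₀ _ hμj.ne']
    · subst h2
      rw [Nat.cast_natAbs, Int.cast_abs, div_mul_cancel₀ _ hμj.ne']
    · have : μ i = 0 := by
        by_contra h0
        exact (hsupp i h0).elim h2 h1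
      simp [this]
  refine ⟨c, fun h0 => ?_, fun i hi => hμl i fun h0 => hi ?_, ?_, ?_⟩
  · have := hc j₀
    rw [h0, div_mul_cancel₀ _ hμj.ne'] at this
    simp only [Pi.zero_apply, Nat.cast_zero] at this
    exact hdet0 (abs_eq_zero.1 this.symm)
  · have := hc i
    rw [h0, mul_zero] at this
    exact_mod_cast this
  · ext j
    have : ((∑ i, c i • f i j : ℤ) : ℝ) = 0 := by
      have h := congrFun hrel j
      simp only [Finset.sum_apply, Pi.smul_apply, smul_eq_mul, Pi.zero_apply] at h
      push_cast [nsmul_eq_mul]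
      simp only [hc, mul_assoc, ← Finset.mul_sum, h, mul_zero]
    rw [Finset.sum_apply]
    exact_mod_cast this
  · have hcard : Fintype.card s = s.card := Fintype.card_coe s
    have hb : ∀ i, c i ≠ 0 → (c i : ℝ) ≤ (√(s.card : ℝ) * m) ^ s.card := by
      intro i hi
      simp only [c] at hi ⊢
      split_ifs at hi ⊢ with h1 h2
      · rw [Nat.cast_natAbs, Int.cast_abs]
        have h := abs_det_le_sqrt_card_mul_pow
          ((Q.updateCol ⟨i, h1⟩ q).map (Int.cast : ℤ → ℝ)) (m := m) (fun r i' => by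
            simp only [map_apply, updateCol_apply]
            split_ifs
            · exact hm _ _
            · exact hm _ _)
        rw [hcard] at h
        simpa only [z, cramer_apply, Int.cast_det] using h
      · rw [Nat.cast_natAbs, Int.cast_abs, hQ]
        have h := abs_det_le_sqrt_card_mul_pow (Q.map (Int.cast : ℤ → ℝ)) (m := m)
          (fun r i' => hm _ _)
        rwa [hcard] at h
      · exact absurd rfl hi
    have hsum : ∑ i, (c i : ℝ) = ∑ i ∈ insert j₀ s, (c i : ℝ) := by
      refine (Finset.sum_subset (Finset.subset_univ _) fun i _ hi => ?_).symm
      rw [Finset.mem_insert, not_or] at hi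
      simp [c, hi.1, hi.2]
    have hj₀c : c j₀ ≠ 0 := by
      simp only [c, hj₀, dif_neg, not_false_eq_true, if_true]
      exact Int.natAbs_ne_zero.2 (by exact_mod_cast hdet0)
    have hb' : ∀ i, (c i : ℝ) ≤ (√(s.card : ℝ) * m) ^ s.card := by
      intro i
      by_cases hi : c i = 0
      · rw [hi, Nat.cast_zero]
        exact (Nat.cast_nonneg _).trans (hb j₀ hj₀c)
      · exact hb i hi
    rw [hsum]
    refine (Finset.sum_le_card_nsmul _ _ _ fun i _ => hb' i).trans ?_
    rw [Finset.card_insert_of_notMem hj₀, nsmul_eq_mul]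
    push_cast
    exact hK s.card (fun i => s.equivFin.symm i)
      (hli'.comp _ s.equivFin.symm.injective)

/-- A nonnegative relation containing no integer relation other than possibly itself has
coefficient sum at most the size of its support times the bound for circuits. -/
theorem sum_le_card_support_mul {ι κ : Type*} [Fintype ι] [Fintype κ] (f : ι → κ → ℤ) {m K : ℝ}
    (hm : ∀ i j, |(f i j : ℝ)| ≤ m)
    (hK : ∀ (k : ℕ) (e : Fin k → ι), LinearIndependent ℝ (fun i j => (f (e i) j : ℝ)) →
      ((k : ℝ) + 1) * (√(k : ℝ) * m) ^ k ≤ K)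
    (l : ι → ℝ) (hl : ∀ i, 0 ≤ l i) (hf : ∀ j, ∑ i, l i * f i j = 0)
    (hmin : ∀ c : ι → ℕ, c ≠ 0 → ∑ i, c i • f i = 0 → (∀ i, (c i : ℝ) ≤ l i) →
      ∑ i, l i ≤ ∑ i, (c i : ℝ)) :
    ∑ i, l i ≤ (Finset.univ.filter fun i => l i ≠ 0).card * K := by
  classical
  induction hn : (Finset.univ.filter fun i => l i ≠ 0).card using Nat.strong_induction_on
    generalizing l with
  | _ n ih =>
  by_cases hl0 : l = 0
  · subst hl0
    simp at hn
    simp [← hn]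
  obtain ⟨c, hc0, hcl, hcf, hcK⟩ := exists_circuit f hm hK l hl hl0 hf
  have hc_nonneg : (0 : ℝ) ≤ ∑ i, (c i : ℝ) := Finset.sum_nonneg fun _ _ => Nat.cast_nonneg _
  have hK0 : 0 ≤ K := hc_nonneg.trans hcK
  have hn1 : 1 ≤ n := by
    rw [← hn, Nat.one_le_iff_ne_zero, Finset.card_ne_zero]
    obtain ⟨j, hj⟩ := Function.ne_iff.1 hl0
    exact ⟨j, by simpa using hj⟩
  by_cases hle : ∀ i, (c i : ℝ) ≤ l i
  · calc ∑ i, l i ≤ K := (hmin c hc0 hcf hle).trans hcK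
      _ = 1 * K := (one_mul _).symm
      _ ≤ n * K := by gcongr; exact_mod_cast hn1
  push Not at hle
  obtain ⟨i₂, hi₂⟩ := hle
  have hi₂c : c i₂ ≠ 0 := fun h => by
    rw [h, Nat.cast_zero] at hi₂
    exact hi₂.not_ge (hl i₂)
  obtain ⟨i₁, hi₁, hα⟩ := Finset.exists_min_image (Finset.univ.filter fun i => c i ≠ 0)
    (fun i => l i / c i) ⟨i₂, by simpa using hi₂c⟩
  simp only [Finset.mem_filter, Finset.mem_univ, true_and] at hi₁ hα
  have hcpos : ∀ i, c i ≠ 0 → (0 : ℝ) < c i := fun i hi => by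
    exact_mod_cast Nat.pos_of_ne_zero hi
  -- The largest multiple of the circuit that can be subtracted. Since the circuit does not fit
  -- below `l`, `α ≤ 1`: at most `K` is lost while the support shrinks.
  set α := l i₁ / c i₁ with hαdef
  have hα0 : 0 ≤ α := div_nonneg (hl _) (Nat.cast_nonneg _)
  have hα1 : α ≤ 1 := (hα i₂ hi₂c).trans ((div_le_one (hcpos _ hi₂c)).2 hi₂.le)
  let l' : ι → ℝ := fun i => l i - α * c i
  have hl'l : ∀ i, l' i ≤ l i := fun i => by
    have : 0 ≤ α * c i := mul_nonneg hα0 (Nat.cast_nonneg _)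
    simp only [l']
    linarith
  have hl' : ∀ i, 0 ≤ l' i := fun i => by
    simp only [l', sub_nonneg]
    by_cases hi : c i = 0
    · simpa [hi] using hl i
    · exact (le_div_iff₀ (hcpos i hi)).1 (hα i hi)
  have hlt : (Finset.univ.filter fun i => l' i ≠ 0).card < n := by
    rw [← hn]
    refine Finset.card_lt_card (Finset.ssubset_iff_of_subset ?_ |>.2 ⟨i₁, ?_, ?_⟩)
    · intro i hi
      simp only [Finset.mem_filter, Finset.mem_univ, true_and] at hi ⊢
      exact fun h0 => hi (le_antisymm ((hl'l i).trans h0.le) (hl' i))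
    · simpa using hcl i₁ hi₁
    · simp [l', hαdef, div_mul_cancel₀ _ (hcpos _ hi₁).ne']
  have hcf' : ∀ j, ∑ i, (c i : ℝ) * f i j = 0 := fun j => by
    have := congrArg (Int.cast : ℤ → ℝ) (congrFun hcf j)
    simpa using this
  have key := ih _ hlt l' hl'
    (fun j => by
      simp only [l', sub_mul, Finset.sum_sub_distrib, hf, mul_assoc, ← Finset.mul_sum, hcf']
      simp)
    (fun c' h0 h1 h2 => (Finset.sum_le_sum fun i _ => hl'l i).trans
      (hmin c' h0 h1 fun i => (h2 i).trans (hl'l i))) rfl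
  have hsplit : ∑ i, l i = ∑ i, l' i + α * ∑ i, (c i : ℝ) := by
    simp only [l', Finset.sum_sub_distrib, ← Finset.mul_sum]
    ring
  have h1 : α * ∑ i, (c i : ℝ) ≤ 1 * K :=
    mul_le_mul hα1 hcK hc_nonneg zero_le_one
  have h2 : (((Finset.univ.filter fun i => l' i ≠ 0).card : ℝ) + 1) * K ≤ n * K := by
    gcongr
    exact_mod_cast hlt
  rw [hsplit]
  linarith

/-- The length of a zero-sum family of integer vectors without proper zero-sum subfamilies. -/
theorem card_le_of_irreducible_zero_sum {ι κ : Type*} [Fintype ι] [Fintype κ] [DecidableEq κ]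
    (w : ι → κ → ℤ) {m K : ℝ}
    (hm : ∀ i j, |(w i j : ℝ)| ≤ m)
    (hK : ∀ (k : ℕ) (e : Fin k → ι), LinearIndependent ℝ (fun i j => (w (e i) j : ℝ)) →
      ((k : ℝ) + 1) * (√(k : ℝ) * m) ^ k ≤ K)
    (hw : ∑ i, w i = 0)
    (hirr : ∀ J : Finset ι, J.Nonempty → ∑ i ∈ J, w i = 0 → J = Finset.univ) :
    (Fintype.card ι : ℝ) ≤ (Finset.univ.image w).card * K := by
  classical
  set W := Finset.univ.image w with hW
  have hsec : ∀ x : W, ∃ i, w i = x := fun x => by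
    obtain ⟨i, -, hi⟩ := Finset.mem_image.1 x.2
    exact ⟨i, hi⟩
  choose σ hσ using hsec
  let F : (κ → ℤ) → Finset ι := fun x => Finset.univ.filter fun i => w i = x
  have hmem : ∀ i, w i ∈ W := fun i => Finset.mem_image_of_mem w (Finset.mem_univ i)
  have hcard : ∑ x : W, ((F x).card : ℝ) = Fintype.card ι := by
    rw [Finset.sum_coe_sort W (fun x => ((F x).card : ℝ)), ← Nat.cast_sum,
      ← Finset.card_eq_sum_card_fiberwise (s := Finset.univ) (fun i _ => hmem i)]
    rfl
  have hfib : ∀ G : (κ → ℤ) → Finset ι, (∀ x, G x ⊆ F x) →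
      ∑ i ∈ W.biUnion G, w i = ∑ x : W, (G x).card • (x : κ → ℤ) := by
    intro G hG
    rw [Finset.sum_biUnion, ← Finset.sum_coe_sort W]
    · refine Finset.sum_congr rfl fun x _ => ?_
      rw [← Finset.sum_const]
      exact Finset.sum_congr rfl fun i hi => (Finset.mem_filter.1 (hG x hi)).2
    · intro x _ y _ hxy
      refine Finset.disjoint_left.2 fun i hi hi' => hxy ?_
      rw [← (Finset.mem_filter.1 (hG x hi)).2, ← (Finset.mem_filter.1 (hG y hi')).2]
  have hbF : W.biUnion F = Finset.univ := by
    ext i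
    simp only [Finset.mem_biUnion, Finset.mem_univ, iff_true]
    exact ⟨w i, hmem i, by simp [F]⟩
  have main := sum_le_card_support_mul (fun x : W => (x : κ → ℤ)) (m := m) (K := K)
    (fun x j => by rw [← hσ x]; exact hm _ _)
    (fun k e he => hK k (σ ∘ e) (by simpa only [Function.comp, hσ] using he))
    (fun x => ((F x).card : ℝ)) (fun _ => Nat.cast_nonneg _)
    (fun j => by
      have h := hfib F fun _ => subset_rfl
      rw [hbF, hw] at h
      have := congrArg (Int.cast : ℤ → ℝ) (congrFun h j)
      simpa using this.symm)
    (fun c hc0 hcf hcl => by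
      -- A smaller integral relation `c` is realized by an actual subfamily: choose `c x` indices in
      -- the fibre over `x`.
      have hex : ∀ x : κ → ℤ, ∃ G ⊆ F x, ∀ h : x ∈ W, G.card = c ⟨x, h⟩ := by
        intro x
        by_cases h : x ∈ W
        · have : c ⟨x, h⟩ ≤ (F x).card := by exact_mod_cast hcl ⟨x, h⟩
          obtain ⟨G, hG, hGc⟩ := Finset.exists_subset_card_eq this
          exact ⟨G, hG, fun _ => hGc⟩
        · exact ⟨∅, Finset.empty_subset _, fun h' => absurd h' h⟩
      choose G hGF hGc using hex
      have hGc' : ∀ x : W, (G x).card = c x := fun x => hGc x x.2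
      have hJ : W.biUnion G = Finset.univ := by
        refine hirr _ ?_ ?_
        · obtain ⟨x, hx⟩ := Function.ne_iff.1 hc0
          have : (G x).Nonempty := by
            rw [← Finset.card_ne_zero, hGc' x]
            exact hx
          obtain ⟨i, hi⟩ := this
          exact ⟨i, Finset.mem_biUnion.2 ⟨x, x.2, hi⟩⟩
        · rw [hfib G hGF, ← hcf]
          exact Finset.sum_congr rfl fun x _ => by rw [hGc' x]
      rw [hcard, ← Finset.card_univ, ← hJ]
      have : (W.biUnion G).card ≤ ∑ x : W, c x := by
        refine Finset.card_biUnion_le.trans_eq ?_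
        rw [← Finset.sum_coe_sort W]
        exact Finset.sum_congr rfl fun x _ => hGc' x
      exact_mod_cast this)
  rw [hcard] at main
  refine main.trans ?_
  have hK0 : 0 ≤ K := by
    have := hK 0 Fin.elim0 linearIndependent_empty_type
    simp at this
    linarith
  gcongr
  exact (Finset.card_le_univ _).trans_eq (Fintype.card_coe W)

/-! ### Conformal decompositions -/

theorem l1_pos {n : Type*} [Fintype n] {v : n → ℤ} (hv : v ≠ 0) : 0 < l1 v := by
  obtain ⟨i, hi⟩ := Function.ne_iff.1 hv
  exact Finset.sum_pos' (fun _ _ => abs_nonneg _) ⟨i, Finset.mem_univ i, abs_pos.2 hi⟩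

theorem CommonOrthant.l1_add {n : Type*} [Fintype n] {u v : n → ℤ}
    (h : CommonOrthant (u + v) u v) : l1 (u + v) = l1 u + l1 v := by
  simp only [l1, ← Finset.sum_add_distrib, Pi.add_apply]
  refine Finset.sum_congr rfl fun i _ => ?_
  rcases h i with ⟨-, h1, h2⟩ | ⟨-, h1, h2⟩
  · rw [abs_of_nonneg h1, abs_of_nonneg h2, abs_of_nonneg (add_nonneg h1 h2)]
  · rw [abs_of_nonpos h1, abs_of_nonpos h2, abs_of_nonpos (add_nonpos h1 h2), neg_add]

theorem l1_sum_le {ι n : Type*} [Fintype ι] [Fintype n] (u : ι → n → ℤ) :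
    l1 (∑ i, u i) ≤ ∑ i, l1 (u i) := by
  simp only [l1, Finset.sum_apply]
  rw [Finset.sum_comm]
  exact Finset.sum_le_sum fun j _ => Finset.abs_sum_le_sum_abs _ _

theorem CommonOrthant.symm {n : Type*} {u v w : n → ℤ} (h : CommonOrthant u v w) :
    CommonOrthant u w v := fun i => by have := h i; omega

/-- Every kernel vector is a conformal sum of Graver basis elements. -/
theorem exists_graver_decomposition {m n : Type*} [Fintype n] (E : Matrix m n ℤ) (v : n → ℤ)
    (hv : E *ᵥ v = 0) :
    ∃ (ι : Type) (_ : Fintype ι) (u : ι → n → ℤ),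
      (∀ i, u i ∈ graver E ∧ Conformal (u i) v) ∧ ∑ i, u i = v := by
  induction hl : (l1 v).toNat using Nat.strong_induction_on generalizing v with
  | _ k ih =>
  by_cases h0 : v = 0
  · exact ⟨Empty, inferInstance, Empty.elim, fun i => i.elim, by simp [h0]⟩
  by_cases hg : v ∈ graver E
  · exact ⟨Unit, inferInstance, fun _ => v, fun _ => ⟨hg, Conformal.refl v⟩, by simp⟩
  obtain ⟨a, b, ha0, hb0, ha, hb, rfl, hab⟩ : ∃ v' v'' : n → ℤ, v' ≠ 0 ∧ v'' ≠ 0 ∧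
      E *ᵥ v' = 0 ∧ E *ᵥ v'' = 0 ∧ v = v' + v'' ∧ CommonOrthant v v' v'' := by
    by_contra h
    exact hg ⟨h0, hv, h⟩
  have hl1 := hab.l1_add
  have hpa := l1_pos ha0
  have hpb := l1_pos hb0
  obtain ⟨ι₁, _, u₁, h₁, hs₁⟩ := ih _ (by omega) a ha rfl
  obtain ⟨ι₂, _, u₂, h₂, hs₂⟩ := ih _ (by omega) b hb rfl
  have hb' : Conformal b (a + b) := by
    rw [add_comm] at hab ⊢
    exact hab.symm.conformal
  refine ⟨ι₁ ⊕ ι₂, inferInstance, Sum.elim u₁ u₂, ?_, by simp [hs₁, hs₂]⟩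
  rintro (i | i)
  · exact ⟨(h₁ i).1, (h₁ i).2.trans hab.conformal⟩
  · exact ⟨(h₂ i).1, (h₂ i).2.trans hb'⟩

/-- Within one orthant nothing cancels. -/
theorem sum_ne_zero_of_conformal {ι n : Type*} {u : ι → n → ℤ} {v : n → ℤ}
    (hu : ∀ i, Conformal (u i) v) (hu0 : ∀ i, u i ≠ 0) {J : Finset ι} (hJ : J.Nonempty) :
    ∑ i ∈ J, u i ≠ 0 := by
  intro h
  obtain ⟨i, hi⟩ := hJ
  refine hu0 i (funext fun j => ?_)
  have hj : ∑ i ∈ J, u i j = 0 := by simpa using congrFun h j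
  rcases le_total 0 (v j) with hv | hv
  · exact (Finset.sum_eq_zero_iff_of_nonneg fun i _ => by have := hu i j; omega).1 hj i hi
  · exact (Finset.sum_eq_zero_iff_of_nonpos fun i _ => by have := hu i j; omega).1 hj i hi

theorem conformal_sum {ι n : Type*} [Fintype ι] {u : ι → n → ℤ} {v : n → ℤ}
    (hu : ∀ i, Conformal (u i) v) (hsum : ∑ i, u i = v) (J : Finset ι) :
    Conformal (∑ i ∈ J, u i) v := by
  classical
  intro j
  have h1 : ∑ i ∈ J, u i j + ∑ i ∈ Jᶜ, u i j = v j := by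
    rw [Finset.sum_add_sum_compl, ← hsum, Finset.sum_apply]
  rw [Finset.sum_apply]
  rcases le_total 0 (v j) with hv | hv
  · have h2 : 0 ≤ ∑ i ∈ J, u i j := Finset.sum_nonneg fun i _ => by have := hu i j; omega
    have h3 : 0 ≤ ∑ i ∈ Jᶜ, u i j := Finset.sum_nonneg fun i _ => by have := hu i j; omega
    omega
  · have h2 : ∑ i ∈ J, u i j ≤ 0 := Finset.sum_nonpos fun i _ => by have := hu i j; omega
    have h3 : ∑ i ∈ Jᶜ, u i j ≤ 0 := Finset.sum_nonpos fun i _ => by have := hu i j; omega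
    omega

theorem neg_mem_graver {m n : Type*} [Fintype n] {E : Matrix m n ℤ} {v : n → ℤ}
    (hv : v ∈ graver E) : -v ∈ graver E := by
  refine ⟨neg_ne_zero.2 hv.1, by rw [mulVec_neg, hv.2.1, neg_zero], ?_⟩
  rintro ⟨a, b, ha0, hb0, ha, hb, hab, ho⟩
  refine hv.2.2 ⟨-a, -b, neg_ne_zero.2 ha0, neg_ne_zero.2 hb0, by rw [mulVec_neg, ha, neg_zero],
    by rw [mulVec_neg, hb, neg_zero], by rw [← neg_neg v, hab, neg_add], fun i => ?_⟩
  have := ho i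
  simp only [Pi.neg_apply] at *
  omega

/-! ### The upper blocks -/

/-- The vector `(x, y¹ + ⋯ + yᴺ)` belonging to `(x, y¹, …, yᴺ)`. -/
def aggregate {nA nB N : ℕ} (v : Fin nB ⊕ Fin nA × Fin N → ℤ) : Fin nB ⊕ Fin nA → ℤ :=
  Sum.elim (fun j => v (Sum.inl j)) (fun j => ∑ k, v (Sum.inr (j, k)))

theorem upperMatrix_mulVec {dC nA nB N : ℕ} (C : Matrix (Fin dC) (Fin nB) ℤ)
    (D : Matrix (Fin dC) (Fin nA) ℤ) (v : Fin nB ⊕ Fin nA × Fin N → ℤ) :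
    upperMatrix C D N *ᵥ v = fromCols C D *ᵥ aggregate v := by
  ext i
  simp [upperMatrix, aggregate, mulVec, dotProduct, fromCols, Fintype.sum_sum_type,
    Fintype.sum_prod_type, Finset.mul_sum]

theorem abs_mulVec_le {m n : Type*} [Fintype n] (E : Matrix m n ℤ) (v : n → ℤ) {M : ℝ}
    (hM : ∀ i j, |(E i j : ℝ)| ≤ M) (i : m) : |((E *ᵥ v) i : ℝ)| ≤ M * l1 v := by
  simp only [mulVec, dotProduct, l1, Int.cast_sum, Int.cast_mul, Int.cast_abs, Finset.mul_sum]
  refine (Finset.abs_sum_le_sum_abs _ _).trans (Finset.sum_le_sum fun j _ => ?_)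
  rw [abs_mul]
  exact mul_le_mul_of_nonneg_right (hM i j) (abs_nonneg _)

/-- Preimages of independent vectors are independent. Applied to `fromCols C D`, this bounds the
order of the minors by `nB + nA`, uniformly in `N` and `dC`. -/
theorem card_le_of_linearIndependent_mulVec {m n : Type*} [Fintype n] (E : Matrix m n ℤ) {k : ℕ}
    (t : Fin k → n → ℤ) (h : LinearIndependent ℝ (fun i j => ((E *ᵥ t i) j : ℝ))) :
    k ≤ Fintype.card n := by
  have h' : LinearIndependent ℝ
      ((E.map (Int.cast : ℤ → ℝ)).mulVecLin ∘ fun i j => (t i j : ℝ)) := by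
    convert h using 1
    ext i j
    simp [mulVec, dotProduct]
  simpa using h'.of_comp.fintype_card_le_finrank

theorem multichoose_mono_left {a b : ℕ} (h : a ≤ b) (N : ℕ) :
    a.multichoose N ≤ b.multichoose N := by
  rw [Nat.multichoose_eq, Nat.multichoose_eq]
  exact Nat.choose_le_choose _ (by omega)

theorem multichoose_le_pow {η : ℕ} (hη : 1 ≤ η) (N : ℕ) :
    η.multichoose N ≤ (N + η) ^ (η - 1) := by
  rw [Nat.multichoose_eq, ← Nat.choose_symm (by omega), show η + N - 1 - N = η - 1 by omega]
  exact (Nat.choose_le_pow _ _).trans (Nat.pow_le_pow_left (by omega) _)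

/-- Multisets number at most `(N + η) ^ (η - 1)`; the spare factor `N + η ≥ 2` pays for the 2 coming
from `k + 1 ≤ 2 * dC`. -/
theorem two_mul_multichoose_le_pow {η N : ℕ} (hN : 1 ≤ N) :
    2 * η.multichoose N ≤ (N + η) ^ η := by
  obtain ⟨N, rfl⟩ := Nat.exists_eq_add_of_le' hN
  rcases Nat.eq_zero_or_pos η with rfl | hη
  · simp
  · calc 2 * η.multichoose (N + 1) ≤ (N + 1 + η) * (N + 1 + η) ^ (η - 1) :=
        Nat.mul_le_mul (by omega) (multichoose_le_pow hη _)
      _ = (N + 1 + η) ^ η := by rw [← pow_succ', Nat.sub_add_cancel hη]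

/-- The number of values of an aggregate on building blocks. -/
theorem card_image_aggregate_le {ι : Type*} [Fintype ι] {nA nB N ξ η : ℕ}
    {X : Finset (Fin nB → ℤ)} {Y : (Fin nB → ℤ) → Finset (Fin nA → ℤ)} (hX : X.card ≤ ξ)
    (hY : ∀ x ∈ X, (Y x).card ≤ η) (u : ι → Fin nB ⊕ Fin nA × Fin N → ℤ)
    (hu : ∀ i, (fun j => u i (Sum.inl j)) ∈ X ∧
      ∀ k, (fun j => u i (Sum.inr (j, k))) ∈ Y (fun j => u i (Sum.inl j))) :
    (Finset.univ.image fun i => aggregate (u i)).card ≤ ξ * η.multichoose N := by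
  classical
  -- Only the multiset of the `N` second-stage blocks matters for their sum, hence `Sym` rather than
  -- tuples.
  have hsub : (Finset.univ.image fun i => aggregate (u i)) ⊆ X.biUnion fun x =>
      (Finset.univ : Finset (Sym (Y x) N)).image fun S : Sym (Y x) N =>
        Sum.elim x ((S : Multiset (Y x)).map Subtype.val).sum := by
    intro t ht
    obtain ⟨i, -, rfl⟩ := Finset.mem_image.1 ht
    refine Finset.mem_biUnion.2 ⟨_, (hu i).1, Finset.mem_image.2
      ⟨⟨Finset.univ.val.map fun k => ⟨_, (hu i).2 k⟩, by simp⟩, Finset.mem_univ _, ?_⟩⟩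
    simp only [Sym.coe_mk, Multiset.map_map, Function.comp_def, aggregate]
    congr 1
    ext j
    exact Finset.sum_apply j Finset.univ fun k j => u i (Sum.inr (j, k))
  refine (Finset.card_le_card hsub).trans (Finset.card_biUnion_le.trans ?_)
  calc ∑ x ∈ X, _ ≤ ∑ _x ∈ X, η.multichoose N := Finset.sum_le_sum fun x hx => by
        refine Finset.card_image_le.trans ?_
        rw [Finset.card_univ, Sym.card_sym_eq_multichoose, Fintype.card_coe]
        exact multichoose_mono_left (hY x hx) N
    _ ≤ ξ * η.multichoose N := by
        rw [Finset.sum_const, smul_eq_mul]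
        exact Nat.mul_le_mul_right _ hX

/-- Without second stage, conformal Graver elements account for at most half of the first-stage
building blocks. -/
theorem two_mul_card_image_aggregate_le {ι : Type*} [Fintype ι] {dA nA nB : ℕ}
    {A : Matrix (Fin dA) (Fin nA) ℤ} {B : Matrix (Fin dA) (Fin nB) ℤ} {X : Finset (Fin nB → ℤ)}
    (hX : ∀ v ∈ graver (lowerMatrix A B 0), (fun j => v (Sum.inl j)) ∈ X)
    (u : ι → Fin nB ⊕ Fin nA × Fin 0 → ℤ) {v : Fin nB ⊕ Fin nA × Fin 0 → ℤ}
    (hu : ∀ i, u i ∈ graver (lowerMatrix A B 0) ∧ Conformal (u i) v) :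
    2 * (Finset.univ.image fun i => aggregate (u i)).card ≤ X.card := by
  classical
  let p : (Fin nB ⊕ Fin nA → ℤ) → Fin nB → ℤ := fun t j => t (Sum.inl j)
  set T := Finset.univ.image fun i => aggregate (u i) with hT
  have hinj : Set.InjOn p T := by
    intro s hs t ht hst
    obtain ⟨i, -, rfl⟩ := Finset.mem_image.1 hs
    obtain ⟨i', -, rfl⟩ := Finset.mem_image.1 ht
    ext (j | j)
    · exact congrFun hst j
    · simp [aggregate]
  have hinj' : Set.InjOn (fun t => -p t) T := fun s hs t ht hst =>
    hinj hs ht (neg_injective hst)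
  -- `X` contains the `x`-part of each `u i` and, by symmetry of the Graver basis, its negative; no
  -- two elements conformal to `v` can be opposite.
  have hdisj : Disjoint (T.image p) (T.image fun t => -p t) := by
    rw [Finset.disjoint_left]
    rintro x hx hx'
    simp only [hT, Finset.mem_image, Finset.mem_univ, true_and, exists_exists_eq_and] at hx hx'
    obtain ⟨i, rfl⟩ := hx
    obtain ⟨i', h⟩ := hx'
    refine (hu i).1.1 (funext ?_)
    rintro (j | ⟨j, k⟩)
    · have h1 := (hu i).2 (Sum.inl j)
      have h2 := (hu i').2 (Sum.inl j)
      have h3 : - u i' (Sum.inl j) = u i (Sum.inl j) := congrFun h j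
      simp only [Pi.zero_apply]
      omega
    · exact k.elim0
  have hsub : T.image p ∪ T.image (fun t => -p t) ⊆ X := by
    intro x hx
    simp only [hT, Finset.mem_union, Finset.mem_image, Finset.mem_univ, true_and,
      exists_exists_eq_and] at hx
    rcases hx with ⟨i, rfl⟩ | ⟨i, rfl⟩
    · exact hX _ (hu i).1
    · exact hX _ (neg_mem_graver (hu i).1)
  have := Finset.card_le_card hsub
  rw [Finset.card_union_of_disjoint hdisj, Finset.card_image_of_injOn hinj,
    Finset.card_image_of_injOn hinj'] at this
  omega

/-! ### The bounds -/

theorem fourBlock_mulVec_eq_zero_iff {dA dC nA nB N : ℕ} {A : Matrix (Fin dA) (Fin nA) ℤ}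
    {B : Matrix (Fin dA) (Fin nB) ℤ} {C : Matrix (Fin dC) (Fin nB) ℤ}
    {D : Matrix (Fin dC) (Fin nA) ℤ} {v : Fin nB ⊕ Fin nA × Fin N → ℤ} :
    fourBlock A B C D N *ᵥ v = 0 ↔
      upperMatrix C D N *ᵥ v = 0 ∧ lowerMatrix A B N *ᵥ v = 0 := by
  rw [fourBlock, fromRows_mulVec, ← Sum.elim_zero_zero, Sum.elim_eq_iff]

/-- A nonzero `v` has at least one Graver summand, whose positive norm is at most `(nB + N * nA) *
g`. This excludes the degenerate cases in which powers would not be monotone in the exponent. -/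
theorem StochasticConstants.one_le {dA dC nA nB N g ξ η : ℕ} {A : Matrix (Fin dA) (Fin nA) ℤ}
    {B : Matrix (Fin dA) (Fin nB) ℤ} {C : Matrix (Fin dC) (Fin nB) ℤ}
    {D : Matrix (Fin dC) (Fin nA) ℤ} (h : StochasticConstants A B g ξ η)
    {v : Fin nB ⊕ Fin nA × Fin N → ℤ} (hv : v ∈ graver (fourBlock A B C D N)) :
    1 ≤ g ∧ 1 ≤ nB + N * nA := by
  obtain ⟨ι, _, u, hu, hsum⟩ := exists_graver_decomposition (lowerMatrix A B N) v
    (fourBlock_mulVec_eq_zero_iff.1 hv.2.1).2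
  have hι : Nonempty ι := by
    by_contra hι
    rw [not_nonempty_iff] at hι
    exact hv.1 (by rw [← hsum, Finset.univ_eq_empty, Finset.sum_empty])
  obtain ⟨i⟩ := hι
  have h1 := h.l1_le N _ (hu i).1
  have h2 := l1_pos (hu i).1.1
  have h3 : 0 < (nB + N * nA) * g := by
    zify
    exact h2.trans_le h1
  exact ⟨Nat.pos_of_mul_pos_left h3, Nat.pos_of_mul_pos_right h3⟩

/-- The norm of a Graver basis element of a four-block matrix, in terms of a bound `K` for the
circuits and of the number `n` of different values that the upper blocks take on the Graver basis
elements of the lower blocks. -/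
theorem StochasticConstants.exists_l1_le {dA dC nA nB N g ξ η : ℕ}
    {A : Matrix (Fin dA) (Fin nA) ℤ} {B : Matrix (Fin dA) (Fin nB) ℤ}
    {C : Matrix (Fin dC) (Fin nB) ℤ} {D : Matrix (Fin dC) (Fin nA) ℤ}
    (h : StochasticConstants A B g ξ η) {M K : ℝ} (hM : 1 ≤ M)
    (hC : ∀ i j, |(C i j : ℝ)| ≤ M) (hD : ∀ i j, |(D i j : ℝ)| ≤ M)
    (hK : ∀ k : ℕ, k ≤ dC → k ≤ nB + nA →
      ((k : ℝ) + 1) * (√(k : ℝ) * (((nB : ℝ) + N * nA) * M * g)) ^ k ≤ K)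
    {v : Fin nB ⊕ Fin nA × Fin N → ℤ} (hv : v ∈ graver (fourBlock A B C D N)) :
    ∃ n : ℕ, n ≤ ξ * η.multichoose N ∧ (N = 0 → 2 * n ≤ ξ) ∧
      (l1 v : ℝ) ≤ n * K * (((nB : ℝ) + N * nA) * g) := by
  classical
  obtain ⟨hvU, hvL⟩ := fourBlock_mulVec_eq_zero_iff.1 hv.2.1
  obtain ⟨ι, _, u, hu, hsum⟩ := exists_graver_decomposition (lowerMatrix A B N) v hvL
  let w : ι → Fin dC → ℤ := fun i => fromCols C D *ᵥ aggregate (u i)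
  have hwU : ∀ i, w i = upperMatrix C D N *ᵥ u i := fun i => (upperMatrix_mulVec C D (u i)).symm
  have hl1 : ∀ i, (l1 (u i) : ℝ) ≤ ((nB : ℝ) + N * nA) * g := fun i => by
    exact_mod_cast h.l1_le N _ (hu i).1
  have hwsum : ∀ J : Finset ι, ∑ i ∈ J, w i = upperMatrix C D N *ᵥ ∑ i ∈ J, u i := fun J => by
    rw [mulVec_sum]
    exact Finset.sum_congr rfl fun i _ => hwU i
  have hcard : (Fintype.card ι : ℝ) ≤ (Finset.univ.image w).card * K := by
    refine card_le_of_irreducible_zero_sum w (m := ((nB : ℝ) + N * nA) * M * g) ?_ ?_ ?_ ?_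
    · intro i j
      rw [hwU]
      refine (abs_mulVec_le (upperMatrix C D N) (u i) (M := M) ?_ j).trans ?_
      · rintro a (b | b)
        · exact hC a b
        · exact hD a b.1
      · calc M * (l1 (u i) : ℝ) ≤ M * (((nB : ℝ) + N * nA) * g) := by
              gcongr
              exact hl1 i
          _ = _ := by ring
    · intro k e he
      refine hK k ?_ ?_
      · simpa using he.fintype_card_le_finrank
      · simpa using card_le_of_linearIndependent_mulVec (fromCols C D)
          (fun i => aggregate (u (e i))) he
    · rw [hwsum, hsum, hvU]
    -- A zero-sum subfamily yields a kernel vector of the four-block matrix conformal to `v`, hence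
    -- `v` itself; then the complementary summands add up to zero, so there are none.
    · intro J hJ hJ0
      rw [hwsum] at hJ0
      have hJv : ∑ i ∈ J, u i = v := by
        refine eq_of_conformal_of_mem_graver hv
          (sum_ne_zero_of_conformal (fun i => (hu i).2) (fun i => (hu i).1.1) hJ) ?_
          (conformal_sum (fun i => (hu i).2) hsum J)
        refine fourBlock_mulVec_eq_zero_iff.2 ⟨hJ0, ?_⟩
        rw [mulVec_sum]
        exact Finset.sum_eq_zero fun i _ => (hu i).1.2.1
      rw [← Finset.compl_eq_empty_iff]
      by_contra hne
      refine sum_ne_zero_of_conformal (fun i => (hu i).2) (fun i => (hu i).1.1)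
        (Finset.nonempty_iff_ne_empty.2 hne) ?_
      have := Finset.sum_add_sum_compl J u
      rwa [hJv, hsum, add_eq_left] at this
  have himage : (Finset.univ.image w).card ≤
      (Finset.univ.image fun i => aggregate (u i)).card := by
    rw [show w = (fun t => fromCols C D *ᵥ t) ∘ fun i => aggregate (u i) from rfl,
      ← Finset.image_image]
    exact Finset.card_image_le
  obtain ⟨X, Y, hX, hY, hXY⟩ := h.building_blocks
  refine ⟨(Finset.univ.image w).card, himage.trans
    (card_image_aggregate_le hX hY u fun i => hXY N _ (hu i).1), ?_, ?_⟩
  · rintro rfl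
    exact (Nat.mul_le_mul_left 2 himage).trans
      ((two_mul_card_image_aggregate_le (fun v hv => (hXY 0 v hv).1) u hu).trans hX)
  · have h1 : (l1 v : ℝ) ≤ ∑ i, (l1 (u i) : ℝ) := by
      have := l1_sum_le u
      rw [hsum] at this
      exact_mod_cast this
    have h2 : ∑ i, (l1 (u i) : ℝ) ≤ Fintype.card ι * (((nB : ℝ) + N * nA) * g) := by
      simpa using Finset.sum_le_card_nsmul Finset.univ (fun i => (l1 (u i) : ℝ)) _
        fun i _ => hl1 i
    exact h1.trans (h2.trans (by gcongr))

theorem sqrt_mul_pow_le {k d : ℕ} (hk : k ≤ d) {m : ℝ} (hm : 1 ≤ m) :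
    (√(k : ℝ) * m) ^ k ≤ (√(d : ℝ) * m) ^ d := by
  rcases Nat.eq_zero_or_pos d with rfl | hd
  · simp [Nat.le_zero.1 hk]
  have h1 : 1 ≤ √(d : ℝ) := by
    rw [Real.one_le_sqrt]
    exact_mod_cast hd
  calc (√(k : ℝ) * m) ^ k ≤ (√(d : ℝ) * m) ^ k := by gcongr
    _ ≤ (√(d : ℝ) * m) ^ d := pow_le_pow_right₀ (one_le_mul_of_one_le_of_one_le h1 hm) hk

/-- For `N = 0` the power can equal 1, so there the factor 2 must come from the hypothesis `h0`,
which the sign symmetry of the Graver basis supplies. -/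
theorem two_mul_le_mul_add_pow {n ξ η N : ℕ} (h : n ≤ ξ * η.multichoose N)
    (h0 : N = 0 → 2 * n ≤ ξ) : 2 * n ≤ ξ * (N + η) ^ η := by
  rcases Nat.eq_zero_or_pos N with rfl | hN
  · refine (h0 rfl).trans (Nat.le_mul_of_pos_right _ ?_)
    rcases Nat.eq_zero_or_pos η with rfl | hη
    · simp
    · positivity
  · calc 2 * n ≤ ξ * (2 * η.multichoose N) := by linarith
      _ ≤ ξ * (N + η) ^ η := Nat.mul_le_mul_left _ (two_mul_multichoose_le_pow hN)

/-- The bound with an arbitrary estimate `Δ` for the minors. -/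
theorem StochasticConstants.l1_le_of_minors {dA dC nA nB N g ξ η : ℕ}
    {A : Matrix (Fin dA) (Fin nA) ℤ} {B : Matrix (Fin dA) (Fin nB) ℤ}
    {C : Matrix (Fin dC) (Fin nB) ℤ} {D : Matrix (Fin dC) (Fin nA) ℤ}
    (h : StochasticConstants A B g ξ η) (hdC : 1 ≤ dC) {M Δ : ℝ} (hM : 1 ≤ M)
    (hC : ∀ i j, |(C i j : ℝ)| ≤ M) (hD : ∀ i j, |(D i j : ℝ)| ≤ M)
    (hΔ : ∀ k : ℕ, k ≤ dC → k ≤ nB + nA →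
      (√(k : ℝ) * (((nB : ℝ) + N * nA) * M * g)) ^ k ≤ Δ)
    {v : Fin nB ⊕ Fin nA × Fin N → ℤ} (hv : v ∈ graver (fourBlock A B C D N)) :
    (l1 v : ℝ) ≤ ξ * ((N : ℝ) + η) ^ η * dC * Δ * (((nB : ℝ) + N * nA) * g) := by
  have hΔ0 : 0 ≤ Δ := by
    have := hΔ 0 (Nat.zero_le _) (Nat.zero_le _)
    simp only [pow_zero] at this
    linarith
  obtain ⟨n, hn, hn0, hle⟩ := h.exists_l1_le hM hC hD (K := 2 * dC * Δ) (fun k hk hk' => by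
    have h1 : (k : ℝ) + 1 ≤ 2 * dC := by
      have : k + 1 ≤ 2 * dC := by omega
      exact_mod_cast this
    exact mul_le_mul h1 (hΔ k hk hk') (by positivity) (by positivity)) hv
  have h2 : (2 * n : ℝ) ≤ ξ * ((N : ℝ) + η) ^ η := by
    exact_mod_cast two_mul_le_mul_add_pow hn hn0
  calc (l1 v : ℝ) ≤ n * (2 * dC * Δ) * (((nB : ℝ) + N * nA) * g) := hle
    _ = (2 * n) * dC * Δ * (((nB : ℝ) + N * nA) * g) := by ring
    _ ≤ _ := by gcongr

theorem StochasticConstants.mono {dA nA nB g ξ ξ' η : ℕ} {A : Matrix (Fin dA) (Fin nA) ℤ}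
    {B : Matrix (Fin dA) (Fin nB) ℤ} (h : StochasticConstants A B g ξ η) (hξ : ξ ≤ ξ') :
    StochasticConstants A B g ξ' η := by
  obtain ⟨X, Y, hX, hY⟩ := h.building_blocks
  exact ⟨h.entry_le, h.l1_le, X, Y, hX.trans hξ, hY⟩

/-- For fixed blocks, the norms of Graver basis elements grow polynomially. -/
theorem StochasticConstants.exists_l1_le_mul_pow {dA dC nA nB g ξ η : ℕ}
    {A : Matrix (Fin dA) (Fin nA) ℤ} {B : Matrix (Fin dA) (Fin nB) ℤ}
    (h : StochasticConstants A B g ξ η) (C : Matrix (Fin dC) (Fin nB) ℤ)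
    (D : Matrix (Fin dC) (Fin nA) ℤ) :
    ∃ K : ℝ, ∀ N : ℕ, 1 ≤ N → ∀ v ∈ graver (fourBlock A B C D N),
      (l1 v : ℝ) ≤ K * (N : ℝ) ^ (dC + η) := by
  let M : ℝ := 1 + ∑ i, ∑ j, |(C i j : ℝ)| + ∑ i, ∑ j, |(D i j : ℝ)|
  have hC0 : 0 ≤ ∑ i, ∑ j, |(C i j : ℝ)| := by positivity
  have hD0 : 0 ≤ ∑ i, ∑ j, |(D i j : ℝ)| := by positivity
  have hM : 1 ≤ M := by simp only [M]; linarith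
  have hle : ∀ {n : ℕ} (F : Matrix (Fin dC) (Fin n) ℤ) i j,
      |(F i j : ℝ)| ≤ ∑ i, ∑ j, |(F i j : ℝ)| := fun F i j =>
    (Finset.single_le_sum (f := fun j => |(F i j : ℝ)|) (fun _ _ => abs_nonneg _)
      (Finset.mem_univ j)).trans
    (Finset.single_le_sum (f := fun i => ∑ j, |(F i j : ℝ)|)
      (fun _ _ => Finset.sum_nonneg fun _ _ => abs_nonneg _) (Finset.mem_univ i))
  have hC : ∀ i j, |(C i j : ℝ)| ≤ M := fun i j => by
    have := hle C i j
    simp only [M]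
    linarith
  have hD : ∀ i j, |(D i j : ℝ)| ≤ M := fun i j => by
    have := hle D i j
    simp only [M]
    linarith
  -- Here `N + η ≤ (1 + η) * N` contributes `η - 1` powers of `N`, and `nB + N * nA ≤ (nB + nA) * N`
  -- contributes `dC + 1`. The factor `dC + 1`, unlike `2 * dC`, also covers `dC = 0`.
  refine ⟨ξ * (1 + η : ℝ) ^ (η - 1) * ((dC + 1) * (√(dC : ℝ) * ((nB + nA : ℝ) * M * g)) ^ dC) *
    ((nB + nA : ℝ) * g), fun N hN v hv => ?_⟩
  obtain ⟨hg, hs⟩ := h.one_le hv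
  have hg' : (1 : ℝ) ≤ g := by exact_mod_cast hg
  have hs' : (1 : ℝ) ≤ (nB : ℝ) + N * nA := by exact_mod_cast hs
  have hN' : (1 : ℝ) ≤ N := by exact_mod_cast hN
  have hm : 1 ≤ ((nB : ℝ) + N * nA) * M * g :=
    one_le_mul_of_one_le_of_one_le (one_le_mul_of_one_le_of_one_le hs' hM) hg'
  obtain ⟨n, hn, -, hle⟩ := h.exists_l1_le hM hC hD
    (K := (dC + 1) * (√(dC : ℝ) * (((nB : ℝ) + N * nA) * M * g)) ^ dC) (fun k hk _ => by
      have := sqrt_mul_pow_le hk hm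
      gcongr) hv
  -- The truncated exponent `η - 1` is wrong for `η = 0`, but then `multichoose` vanishes for `N ≥
  -- 1`.
  rcases Nat.eq_zero_or_pos η with rfl | hη
  · obtain ⟨N, rfl⟩ := Nat.exists_eq_add_of_le' hN
    have hn0 : n = 0 := by simpa using hn
    rw [hn0] at hle
    refine hle.trans ?_
    simp only [Nat.cast_zero, zero_mul]
    positivity
  have hsN : (nB : ℝ) + N * nA ≤ (nB + nA) * N := by
    nlinarith [(Nat.cast_nonneg nB : (0 : ℝ) ≤ nB)]
  have hn' : (n : ℝ) ≤ ξ * ((1 + η) * N) ^ (η - 1) := by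
    have h1 : (n : ℝ) ≤ ξ * ((N : ℝ) + η) ^ (η - 1) := by
      exact_mod_cast hn.trans (Nat.mul_le_mul_left _ (multichoose_le_pow hη N))
    have h2 : (N : ℝ) + η ≤ (1 + η) * N := by
      nlinarith [(Nat.cast_nonneg η : (0 : ℝ) ≤ η)]
    exact h1.trans (by gcongr)
  calc (l1 v : ℝ) ≤ n * ((dC + 1) * (√(dC : ℝ) * (((nB : ℝ) + N * nA) * M * g)) ^ dC) *
        (((nB : ℝ) + N * nA) * g) := hle
    _ ≤ (ξ * ((1 + η) * N) ^ (η - 1)) *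
        ((dC + 1) * (√(dC : ℝ) * (((nB + nA) * N) * M * g)) ^ dC) * (((nB + nA) * N) * g) := by
        gcongr
    _ = ξ * (1 + η : ℝ) ^ (η - 1) *
        ((dC + 1) * (√(dC : ℝ) * ((nB + nA : ℝ) * M * g)) ^ dC) * ((nB + nA : ℝ) * g) *
        ((N : ℝ) ^ dC * ((N : ℝ) ^ (η - 1) * N)) := by
        rw [show √(dC : ℝ) * (((nB + nA) * N) * M * g) = √(dC : ℝ) * ((nB + nA : ℝ) * M * g) * N
          by ring, mul_pow _ (N : ℝ) dC, mul_pow _ (N : ℝ) (η - 1)]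
        ring
    _ = _ := by rw [← pow_succ, Nat.sub_add_cancel hη, ← pow_add]

end FourBlock

theorem mainTheorem2 {dA nA nB : ℕ}
    (A : Matrix (Fin dA) (Fin nA) ℤ) (B : Matrix (Fin dA) (Fin nB) ℤ) :
    -- the constants of the structure theorem exist
    (∃ g ξ η : ℕ, FourBlock.StochasticConstants A B g ξ η) ∧
    ∀ g ξ₀ η : ℕ, FourBlock.StochasticConstants A B g ξ₀ η →
      -- the bound, after possibly enlarging `ξ₀` to a `ξ` that depends only on `A`, `B`
      -- and the given constants
      (∃ ξ : ℕ, ξ₀ ≤ ξ ∧ FourBlock.StochasticConstants A B g ξ η ∧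
        ∀ (dC : ℕ), 1 ≤ dC →
        ∀ (C : Matrix (Fin dC) (Fin nB) ℤ) (D : Matrix (Fin dC) (Fin nA) ℤ) (M : ℝ), 1 ≤ M →
        (∀ i j, |(C i j : ℝ)| ≤ M) → (∀ i j, |(D i j : ℝ)| ≤ M) →
        ∀ (N : ℕ), ∀ v ∈ FourBlock.graver (FourBlock.fourBlock A B C D N),
          (FourBlock.l1 v : ℝ) ≤
            ξ * ((N : ℝ) + η) ^ η * dC * (√(dC : ℝ) * ((nB : ℝ) + N * nA) * M) ^ dC
              * (((nB : ℝ) + N * nA) * g)) ∧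
      -- the bound for arbitrary constants of the structure theorem
      (∀ (dC : ℕ), 1 ≤ dC →
        ∀ (C : Matrix (Fin dC) (Fin nB) ℤ) (D : Matrix (Fin dC) (Fin nA) ℤ) (M : ℝ), 1 ≤ M →
        (∀ i j, |(C i j : ℝ)| ≤ M) → (∀ i j, |(D i j : ℝ)| ≤ M) →
        ∀ (N : ℕ), ∀ v ∈ FourBlock.graver (FourBlock.fourBlock A B C D N),
          (FourBlock.l1 v : ℝ) ≤
            ξ₀ * ((N : ℝ) + η) ^ η * dC * (√(dC : ℝ) * ((nB : ℝ) + N * nA) * M * g) ^ dC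
              * (((nB : ℝ) + N * nA) * g)) ∧
      -- for fixed blocks the norms are `O(N ^ (dC + η))`
      (∀ (dC : ℕ) (C : Matrix (Fin dC) (Fin nB) ℤ) (D : Matrix (Fin dC) (Fin nA) ℤ),
        ∃ K : ℝ, ∀ (N : ℕ), 1 ≤ N →
          ∀ v ∈ FourBlock.graver (FourBlock.fourBlock A B C D N),
            (FourBlock.l1 v : ℝ) ≤ K * (N : ℝ) ^ (dC + η)) := by
  refine ⟨FourBlock.exists_stochasticConstants A B, fun g ξ₀ η h => ⟨?_, ?_, fun dC C D =>
    h.exists_l1_le_mul_pow C D⟩⟩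
  -- Minors have order `k ≤ nB + nA`, so `(g + 1) ^ (nB + nA)` absorbs `g ^ k`; the base `g + 1`
  -- ensures `ξ₀ ≤ ξ` even for `g = 0`.
  · have hξ : ξ₀ ≤ ξ₀ * (g + 1) ^ (nB + nA) := Nat.le_mul_of_pos_right _ (by positivity)
    refine ⟨ξ₀ * (g + 1) ^ (nB + nA), hξ, h.mono hξ, fun dC hdC C D M hM hC hD N v hv => ?_⟩
    obtain ⟨hg, hs⟩ := h.one_le hv
    have hg' : (1 : ℝ) ≤ g := by exact_mod_cast hg
    have hs' : (1 : ℝ) ≤ (nB : ℝ) + N * nA := by exact_mod_cast hs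
    have hm : 1 ≤ ((nB : ℝ) + N * nA) * M := one_le_mul_of_one_le_of_one_le hs' hM
    refine (h.l1_le_of_minors hdC hM hC hD (Δ := (g + 1 : ℝ) ^ (nB + nA) *
      (√(dC : ℝ) * (((nB : ℝ) + N * nA) * M)) ^ dC) (fun k hk hk' => ?_) hv).trans_eq ?_
    · have h1 : (g : ℝ) ^ k ≤ (g + 1 : ℝ) ^ (nB + nA) :=
        (pow_le_pow_right₀ hg' hk').trans (by gcongr; linarith)
      rw [← mul_assoc, mul_pow, mul_comm]
      exact mul_le_mul h1 (FourBlock.sqrt_mul_pow_le hk hm) (by positivity) (by positivity)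
    · push_cast
      ring
  · intro dC hdC C D M hM hC hD N v hv
    obtain ⟨hg, hs⟩ := h.one_le hv
    have hg' : (1 : ℝ) ≤ g := by exact_mod_cast hg
    have hs' : (1 : ℝ) ≤ (nB : ℝ) + N * nA := by exact_mod_cast hs
    have hm : 1 ≤ ((nB : ℝ) + N * nA) * M * g :=
      one_le_mul_of_one_le_of_one_le (one_le_mul_of_one_le_of_one_le hs' hM) hg'
    refine (h.l1_le_of_minors hdC hM hC hD (Δ := (√(dC : ℝ) * (((nB : ℝ) + N * nA) * M * g)) ^ dC)
      (fun k hk _ => FourBlock.sqrt_mul_pow_le hk hm) hv).trans_eq ?_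
    ring
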